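/- Let $d\ge 1$ and let $U_0,\dots,U_d$ be $d\times d$ unitary matrices whose column bases $\{U_t|k\rangle\}_{k=1}^d$, $0\le t\le d$, are pairwise mutually unbiased, i.e. $|\langle j|U_s^\dagger U_t|k\rangle|=1/\sqrt d$ for all $s\neq t$ and all $j,k$ (for instance, a complete set of $d+1$ mutually unbiased bases in a prime power dimension $d$). Let $$\rho=\frac1{(d+1)d}\sum_{k=1}^{d}\sum_{t=0}^{d}\bigl(|k\rangle\langle k|\otimes|t\rangle\langle t|\bigr)_A\otimes\bigl(U_t|k\rangle\langle k|U_t^\dagger\bigr)_B ,$$ and let $\rho'$ be the state obtained from $\rho$ when Alice sends Bob the classical basis label $t$ (keeping a copy), i.e. $$\rho'=\frac1{(d+1)d}\sum_{k,t}\bigl(|k\rangle\langle k|\otimes|t\rangle\langle t|\bigr)_A\otimes\bigl(|t\rangle\langle t|\otimes U_t|k\rangle\langle k|U_t^\dagger\bigr)_B .$$ For a bipartite state $\sigma$ let $I_c(\sigma)$ be the supremum, over all pairs of local measurements (POVMs $M_A$ and $M_B$ with finitely many outcomes), of the mutual information $I(A:B)=H(p_A)+H(p_B)-H(p_{AB})$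 of the outcome distribution $p_{AB}(i,j)=\mathrm{Tr}\,[((M_A)_i\otimes (M_B)_j)\,\sigma]$, where $p_A,p_B$ are its marginals, $H$ is the Shannon entropy, and all logarithms are to base $2$. Then $I_c(\rho)$ and $I_c(\rho')$ are finite and $$I_c(\rho)\le 1-\log\Bigl(1+\frac1d\Bigr),\qquad I_c(\rho')=\log(d+1)+\log d,\qquad I_c(\rho')-I_c(\rho)\ge 2\log(d+1)-1 .$$ -/

import Mathlib

open scoped Kronecker Matrix ComplexOrder

noncomputable section

namespace QuantumLocking

/-- Shannon entropy, in bits, of a finitely supported distribution `p`: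
`H(p) = -∑ p log₂ p`, with `0 log 0 = 0`. -/
def entropy {α : Type*} [Fintype α] (p : α → ℝ) : ℝ :=
  -∑ a, p a * Real.logb 2 (p a)

/-- Classical mutual information `I(A : B) = H(p_A) + H(p_B) - H(p_AB)` (in bits) of a joint
distribution `p` on `α × β`. -/
def mutualInfo {α β : Type*} [Fintype α] [Fintype β] (p : α × β → ℝ) : ℝ :=
  entropy (fun a => ∑ b, p (a, b)) + entropy (fun b => ∑ a, p (a, b)) - entropy p

/-- A POVM with outcome set `Ω` on the Hilbert space `ℂ^α`: positive semidefinite operators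
summing to the identity. -/
structure POVM (Ω α : Type*) [Fintype Ω] [Fintype α] [DecidableEq α] where
  effect : Ω → Matrix α α ℂ
  posSemidef : ∀ ω, (effect ω).PosSemidef
  sum_eq_one : ∑ ω, effect ω = 1

/-- The joint outcome distribution `p_AB(i, j) = Tr((M_i ⊗ N_j) ρ)` of the local measurement
`M ⊗ N` on the bipartite operator `ρ`. -/
def outcomeDist {Ω Ω' α β : Type*} [Fintype Ω] [Fintype Ω'] [Fintype α] [Fintype β]
    [DecidableEq α] [DecidableEq β] (ρ : Matrix (α × β) (α × β) ℂ)
    (M : POVM Ω α) (N : POVM Ω' β) : Ω × Ω' → ℝ :=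
  fun o => (((M.effect o.1) ⊗ₖ (N.effect o.2)) * ρ).trace.re

/-- All values of the mutual information `I(A : B)` that local measurements `M_A ⊗ M_B`
(POVMs with arbitrary finite numbers of outcomes) produce on `ρ`. -/
def localInfoValues {α β : Type*} [Fintype α] [Fintype β] [DecidableEq α] [DecidableEq β]
    (ρ : Matrix (α × β) (α × β) ℂ) : Set ℝ :=
  {x | ∃ (m n : ℕ) (M : POVM (Fin m) α) (N : POVM (Fin n) β),
    x = mutualInfo (outcomeDist ρ M N)}

/-- The classical mutual information `I_c(ρ)` of a bipartite state: the best value of `I(A : B)`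
over all local measurements. -/
def classicalInfo {α β : Type*} [Fintype α] [Fintype β] [DecidableEq α] [DecidableEq β]
    (ρ : Matrix (α × β) (α × β) ℂ) : ℝ :=
  sSup (localInfoValues ρ)

/-- The bases `{U_t |k⟩}_k` of `ℂ^ι` are pairwise mutually unbiased: for `s ≠ t` every inner
product `⟨j| U_s† U_t |k⟩` has modulus `1 / √dim`. -/
def MutuallyUnbiased {ι τ : Type*} [Fintype ι] [DecidableEq ι]
    (U : τ → Matrix.unitaryGroup ι ℂ) : Prop :=
  ∀ s t, s ≠ t → ∀ j k,
    ‖(((U s : Matrix ι ι ℂ)ᴴ * (U t : Matrix ι ι ℂ)) j k)‖ = 1 / √(Fintype.card ι : ℝ)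

/-- The locked state
`ρ = (L d)⁻¹ ∑_{k,t} (|k⟩⟨k| ⊗ |t⟩⟨t|)_A ⊗ (U_t |k⟩⟨k| U_t†)_B`, `L = |τ|`, `d = |ι|`. -/
def lockedState {ι τ : Type*} [Fintype ι] [Fintype τ] [DecidableEq ι] [DecidableEq τ]
    (U : τ → Matrix.unitaryGroup ι ℂ) : Matrix ((ι × τ) × ι) ((ι × τ) × ι) ℂ :=
  ((Fintype.card τ : ℂ) * (Fintype.card ι : ℂ))⁻¹ •
    ∑ k : ι, ∑ t : τ,
      (Matrix.single k k (1 : ℂ) ⊗ₖ Matrix.single t t (1 : ℂ)) ⊗ₖ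
        ((U t : Matrix ι ι ℂ) * Matrix.single k k (1 : ℂ) * (U t : Matrix ι ι ℂ)ᴴ)

/-- The isometry `|t⟩ ⊗ 1 : ℂ^β → ℂ^τ ⊗ ℂ^β` that adjoins a classical register in state `t`. -/
def adjoinLabel {τ β : Type*} [DecidableEq τ] [DecidableEq β] (t : τ) : Matrix (τ × β) β ℂ :=
  Matrix.of fun x b => if x.1 = t ∧ x.2 = b then 1 else 0

/-- Kraus operator `(1 ⊗ |t⟩⟨t|)_A ⊗ (|t⟩ ⊗ 1)_B`: Alice reads the label `t` in the second part
of her system, keeps it, and sends it to Bob. -/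
def sendLabelKraus {ι τ β : Type*} [DecidableEq ι] [DecidableEq τ] [DecidableEq β] (t : τ) :
    Matrix ((ι × τ) × (τ × β)) ((ι × τ) × β) ℂ :=
  ((1 : Matrix ι ι ℂ) ⊗ₖ Matrix.single t t (1 : ℂ)) ⊗ₖ adjoinLabel t

/-- One-way classical communication of the label `t` from Alice to Bob:
`Λ(ρ) = ∑_t K_t ρ K_t†`. -/
def sendLabel {ι τ β : Type*} [Fintype ι] [Fintype τ] [Fintype β]
    [DecidableEq ι] [DecidableEq τ] [DecidableEq β]
    (ρ : Matrix ((ι × τ) × β) ((ι × τ) × β) ℂ) :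
    Matrix ((ι × τ) × (τ × β)) ((ι × τ) × (τ × β)) ℂ :=
  ∑ t : τ,
    (sendLabelKraus t : Matrix ((ι × τ) × (τ × β)) ((ι × τ) × β) ℂ) * ρ *
      (sendLabelKraus t : Matrix ((ι × τ) × (τ × β)) ((ι × τ) × β) ℂ)ᴴ

/-- The state `ρ' = Λ(ρ)` obtained from the locked state when Alice tells Bob the basis label. -/
def unlockedState {ι τ : Type*} [Fintype ι] [Fintype τ] [DecidableEq ι] [DecidableEq τ]
    (U : τ → Matrix.unitaryGroup ι ℂ) : Matrix ((ι × τ) × (τ × ι)) ((ι × τ) × (τ × ι)) ℂ :=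
  sendLabel (lockedState U)

end QuantumLocking

end

-- Both states are classical-quantum: a uniform letter `x = (k, t)`, one of `d (d + 1)`, sits with
-- Alice and a pure state `v x` with Bob. Since Alice's side is diagonal, any measurement of hers is
-- stochastic post-processing of the letter, so by data processing it suffices to bound the
-- information between the letter and Bob's outcome.
--
-- With the label, the vectors `|t⟩ ⊗ U_t|k⟩` form an orthonormal basis; Bob reads off the whole
-- letter and obtains `log (d (d + 1))`, the entropy of the letter.
--
-- Without it, `sum_bornProb_sq_le` shows that every effect `N` satisfies `∑ₓ ⟨vₓ|N|vₓ⟩² ≤ 2 (tr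
-- N)²`: centred projectors from different unbiased bases are Hilbert-Schmidt orthogonal, so
-- Bessel's inequality bounds the sum by `tr N² + (tr N)²`. Hence the letter given Bob's outcome has
-- collision probability at most `2 / (d + 1)²`, and concavity of the logarithm
-- (`mutualInfo_le_of_collision`) bounds the information by `log (2d / (d + 1))`.

namespace QuantumLocking

-- Mutual information of finite distributions

section Entropy

variable {α β ξ : Type*} [Fintype α] [Fintype β] [Fintype ξ]

/-- The tangent-line bound for a summand `a (log₂ a - log₂ b)` of the relative entropy. -/
theorem mul_logb_tangent {a b A B : ℝ} (ha : 0 ≤ a) (hb : 0 ≤ b) (hab : b = 0 → a = 0)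
    (hA : 0 < A) (hB : 0 < B) :
    a * (Real.logb 2 A - Real.logb 2 B) + (a - b * A / B) / Real.log 2
      ≤ a * (Real.logb 2 a - Real.logb 2 b) := by
  have hl : 0 < Real.log 2 := Real.log_pos one_lt_two
  rcases ha.eq_or_lt with rfl | ha
  · have : 0 ≤ b * A / B / Real.log 2 := by positivity
    simp only [zero_mul, zero_sub, zero_add, neg_div]
    linarith
  have hb : 0 < b := hb.lt_of_ne fun h => ha.ne' (hab h.symm)
  -- `log z ≤ z - 1` is tight at `z = 1`, that is at `a / b = A / B`.
  have h := Real.log_le_sub_one_of_pos (show 0 < b * A / (B * a) by positivity)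
  rw [Real.log_div (by positivity) (by positivity), Real.log_mul hb.ne' hA.ne',
    Real.log_mul hB.ne' ha.ne'] at h
  have h2 := mul_le_mul_of_nonneg_left h ha.le
  have h3 : a * (b * A / (B * a) - 1) = b * A / B - a := by field_simp
  rw [h3] at h2
  simp only [Real.logb]
  rw [← sub_div, ← sub_div, mul_div_assoc', mul_div_assoc', ← add_div]
  exact div_le_div_of_nonneg_right (by linarith) hl.le

/-- The log-sum inequality. -/
theorem log_sum_le {a b : ξ → ℝ} (ha : ∀ x, 0 ≤ a x) (hb : ∀ x, 0 ≤ b x)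
    (hab : ∀ x, b x = 0 → a x = 0) :
    (∑ x, a x) * (Real.logb 2 (∑ x, a x) - Real.logb 2 (∑ x, b x))
      ≤ ∑ x, a x * (Real.logb 2 (a x) - Real.logb 2 (b x)) := by
  rcases (Finset.sum_nonneg fun x _ => ha x).eq_or_lt with h | hA
  · have h0 : ∀ x, a x = 0 := fun x =>
      (Finset.sum_eq_zero_iff_of_nonneg fun x _ => ha x).1 h.symm x (Finset.mem_univ x)
    simp [h0]
  have hB : 0 < ∑ x, b x := by
    refine (Finset.sum_nonneg fun x _ => hb x).lt_of_ne fun h => hA.ne' ?_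
    refine Finset.sum_eq_zero fun x _ => hab x ?_
    exact (Finset.sum_eq_zero_iff_of_nonneg fun x _ => hb x).1 h.symm x (Finset.mem_univ x)
  -- With `A`, `B` the total sums, the corrections `a - b * A / B` add up to zero.
  have key := Finset.sum_le_sum fun x (_ : x ∈ Finset.univ) =>
    mul_logb_tangent (ha x) (hb x) (hab x) hA hB
  rw [Finset.sum_add_distrib, ← Finset.sum_mul, ← Finset.sum_div, Finset.sum_sub_distrib,
    ← Finset.sum_div, ← Finset.sum_mul, mul_div_cancel_left₀ _ hB.ne', sub_self, zero_div,
    add_zero] at key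
  exact key

/-- Mutual information as a relative entropy to the product of the marginals. -/
theorem mutualInfo_eq_sum {p : α × β → ℝ} (hp : ∀ x, 0 ≤ p x) :
    mutualInfo p = ∑ b, ∑ a, p (a, b) *
      (Real.logb 2 (p (a, b)) - Real.logb 2 ((∑ b', p (a, b')) * ∑ a', p (a', b))) := by
  have h : ∀ a b, p (a, b) *
      (Real.logb 2 (p (a, b)) - Real.logb 2 ((∑ b', p (a, b')) * ∑ a', p (a', b))) =
      p (a, b) * Real.logb 2 (p (a, b)) - p (a, b) * Real.logb 2 (∑ b', p (a, b'))
        - p (a, b) * Real.logb 2 (∑ a', p (a', b)) := by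
    intro a b
    rcases (hp (a, b)).eq_or_lt with h0 | h0
    · simp [← h0]
    have h1 : 0 < ∑ b', p (a, b') :=
      h0.trans_le (Finset.single_le_sum (fun b' _ => hp (a, b')) (Finset.mem_univ b))
    have h2 : 0 < ∑ a', p (a', b) :=
      h0.trans_le (Finset.single_le_sum (f := fun a' => p (a', b)) (fun a' _ => hp (a', b))
        (Finset.mem_univ a))
    rw [Real.logb_mul h1.ne' h2.ne']
    ring
  simp_rw [h, Finset.sum_sub_distrib]
  rw [Finset.sum_comm (f := fun b a => p (a, b) * Real.logb 2 (p (a, b))),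
    Finset.sum_comm (f := fun b a => p (a, b) * Real.logb 2 (∑ b', p (a, b')))]
  simp_rw [← Finset.sum_mul]
  unfold mutualInfo entropy
  rw [Fintype.sum_prod_type]
  ring

/-- Data processing: coarse-graining the first variable by a stochastic map does not increase the
mutual information. -/
theorem mutualInfo_le_of_stochastic {w : α → ξ → ℝ} {q : ξ × β → ℝ} (hw : ∀ a x, 0 ≤ w a x)
    (hw1 : ∀ x, ∑ a, w a x = 1) (hq : ∀ x, 0 ≤ q x) :
    mutualInfo (fun o : α × β => ∑ x, w o.1 x * q (x, o.2)) ≤ mutualInfo q := by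
  rw [mutualInfo_eq_sum fun o => Finset.sum_nonneg fun x _ => mul_nonneg (hw _ _) (hq _),
    mutualInfo_eq_sum hq]
  refine Finset.sum_le_sum fun b _ => ?_
  have hqb : ∀ x, 0 ≤ ∑ b', q (x, b') := fun x => Finset.sum_nonneg fun _ _ => hq _
  have hqx : 0 ≤ ∑ x', q (x', b) := Finset.sum_nonneg fun _ _ => hq _
  have hmarg : ∑ a, ∑ x, w a x * q (x, b) = ∑ x, q (x, b) := by
    rw [Finset.sum_comm]
    simp_rw [← Finset.sum_mul, hw1, one_mul]
  have hz : ∀ x, (∑ b', q (x, b')) * (∑ x', q (x', b)) = 0 → q (x, b) = 0 := by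
    intro x h
    rcases mul_eq_zero.1 h with h | h
    · exact (Finset.sum_eq_zero_iff_of_nonneg fun _ _ => hq _).1 h b (Finset.mem_univ b)
    · exact (Finset.sum_eq_zero_iff_of_nonneg (f := fun x' => q (x', b)) fun _ _ => hq _).1 h x
        (Finset.mem_univ x)
  simp only [hmarg]
  -- The weight `w a x` cancels inside the logarithm, so the log-sum inequality over `x`, for fixed
  -- `a` and `b`, yields terms that sum over `a` to those of `q`.
  have hterm : ∀ a x, w a x * q (x, b) * (Real.logb 2 (w a x * q (x, b)) -
      Real.logb 2 (w a x * ((∑ b', q (x, b')) * ∑ x', q (x', b)))) =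
      w a x * (q (x, b) * (Real.logb 2 (q (x, b)) -
        Real.logb 2 ((∑ b', q (x, b')) * ∑ x', q (x', b)))) := by
    intro a x
    by_cases h0 : w a x = 0
    · simp [h0]
    by_cases h1 : q (x, b) = 0
    · simp [h1]
    rw [Real.logb_mul h0 h1, Real.logb_mul h0 fun h => h1 (hz x h)]
    ring
  calc _ ≤ ∑ a, ∑ x, w a x * (q (x, b) * (Real.logb 2 (q (x, b)) -
        Real.logb 2 ((∑ b', q (x, b')) * ∑ x', q (x', b)))) := by
        refine Finset.sum_le_sum fun a _ => ?_
        simp_rw [← hterm]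
        have hden : (∑ b', ∑ x, w a x * q (x, b')) * (∑ x', q (x', b)) =
            ∑ x, w a x * ((∑ b', q (x, b')) * ∑ x', q (x', b)) := by
          rw [Finset.sum_comm]
          simp_rw [← Finset.mul_sum, ← mul_assoc, ← Finset.sum_mul]
        rw [hden]
        refine log_sum_le (fun x => mul_nonneg (hw _ _) (hq _))
          (fun x => mul_nonneg (hw _ _) (mul_nonneg (hqb x) hqx)) fun x h => ?_
        rcases mul_eq_zero.1 h with h | h
        · simp [h]
        · simp [hz x h]
    _ = _ := by
        rw [Finset.sum_comm]
        simp_rw [← Finset.sum_mul, hw1, one_mul]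

/-- If the first variable is uniform, the mutual information is at most its entropy. -/
theorem mutualInfo_le_logb_card {q : ξ × β → ℝ} (hq : ∀ x, 0 ≤ q x)
    (hu : ∀ x, ∑ b, q (x, b) = (Fintype.card ξ : ℝ)⁻¹) :
    mutualInfo q ≤ Real.logb 2 (Fintype.card ξ) := by
  rw [mutualInfo_eq_sum hq]
  rcases isEmpty_or_nonempty ξ with hξ | hξ
  · simp
  have hc : (0 : ℝ) < Fintype.card ξ := by exact_mod_cast Fintype.card_pos
  have htot : ∑ b, ∑ x, q (x, b) = 1 := by
    rw [Finset.sum_comm]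
    simp [hu]
  calc _ ≤ ∑ b, ∑ x, q (x, b) * Real.logb 2 (Fintype.card ξ) := by
        refine Finset.sum_le_sum fun b _ => Finset.sum_le_sum fun x _ => ?_
        rcases (hq (x, b)).eq_or_lt with h0 | h0
        · simp [← h0]
        have hle : q (x, b) ≤ ∑ x', q (x', b) :=
          Finset.single_le_sum (f := fun x' => q (x', b)) (fun _ _ => hq _) (Finset.mem_univ x)
        have hlog := Real.logb_le_logb_of_le one_lt_two h0 hle
        refine mul_le_mul_of_nonneg_left ?_ h0.le
        rw [hu, Real.logb_mul (inv_pos.2 hc).ne' (h0.trans_le hle).ne', Real.logb_inv]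
        linarith
    _ = _ := by simp_rw [← Finset.sum_mul, htot, one_mul]

/-- A collision bound: if the first variable is uniform and the conditional distributions given
the second variable have collision probability at most `c / |ξ|`, then the mutual information is at
most `log₂ c`. -/
theorem mutualInfo_le_of_collision {q : ξ × β → ℝ} (hq : ∀ x, 0 ≤ q x)
    (hu : ∀ x, ∑ b, q (x, b) = (Fintype.card ξ : ℝ)⁻¹) {c : ℝ} (hc : 0 < c)
    (hcoll : ∀ b, Fintype.card ξ * ∑ x, q (x, b) ^ 2 ≤ c * (∑ x, q (x, b)) ^ 2) [Nonempty ξ] :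
    mutualInfo q ≤ Real.logb 2 c := by
  rw [mutualInfo_eq_sum hq]
  have hl : 0 < Real.log 2 := Real.log_pos one_lt_two
  have hn : (0 : ℝ) < Fintype.card ξ := by exact_mod_cast Fintype.card_pos
  have htot : ∑ b, ∑ x, q (x, b) = 1 := by
    rw [Finset.sum_comm]
    simp [hu]
  calc _ ≤ ∑ b, (∑ x, q (x, b)) * Real.logb 2 c := by
        refine Finset.sum_le_sum fun b _ => ?_
        set s := ∑ x, q (x, b) with hs
        rcases (Finset.sum_nonneg fun x _ => hq (x, b)).eq_or_lt with h0 | h0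
        · have h0' : ∀ x, q (x, b) = 0 := fun x =>
            (Finset.sum_eq_zero_iff_of_nonneg fun x _ => hq (x, b)).1 h0.symm x
              (Finset.mem_univ x)
          simp [hs, h0']
        have hsp : 0 < s := h0
        -- Jensen's inequality in tangent form: `log z ≤ z - 1` at `z = |ξ| q / (s c)`. The
        -- correction is quadratic in `q`, and its sum over `x` is nonpositive by `hcoll`.
        have hterm : ∀ x, q (x, b) * (Real.logb 2 (q (x, b)) -
            Real.logb 2 ((∑ b', q (x, b')) * s)) ≤ q (x, b) * Real.logb 2 c +
            (Fintype.card ξ / (s * c) * q (x, b) ^ 2 - q (x, b)) / Real.log 2 := by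
          intro x
          rcases (hq (x, b)).eq_or_lt with h1 | h1
          · simp [← h1]
          have h := Real.log_le_sub_one_of_pos
            (show 0 < Fintype.card ξ * q (x, b) / (s * c) by positivity)
          rw [Real.log_div (by positivity) (by positivity), Real.log_mul hn.ne' h1.ne',
            Real.log_mul hsp.ne' hc.ne'] at h
          have h2 := mul_le_mul_of_nonneg_left h h1.le
          rw [hu, Real.logb_mul (inv_pos.2 hn).ne' hsp.ne', Real.logb_inv]
          have h3 : Fintype.card ξ / (s * c) * q (x, b) ^ 2 - q (x, b) =
            q (x, b) * (Fintype.card ξ * q (x, b) / (s * c) - 1) := by ring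
          rw [h3]
          simp only [Real.logb]
          have h4 := div_le_div_of_nonneg_right h2 hl.le
          have h5 : q (x, b) * (Real.log (q (x, b)) / Real.log 2 -
              (-(Real.log (Fintype.card ξ) / Real.log 2) + Real.log s / Real.log 2)) =
              q (x, b) * (Real.log (Fintype.card ξ) + Real.log (q (x, b)) -
                (Real.log s + Real.log c)) / Real.log 2
                + q (x, b) * (Real.log c / Real.log 2) := by ring
          rw [h5]
          linarith
        refine (Finset.sum_le_sum fun x _ => hterm x).trans ?_
        rw [Finset.sum_add_distrib, ← Finset.sum_mul, ← Finset.sum_div, Finset.sum_sub_distrib,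
          ← Finset.mul_sum, ← hs]
        have h6 : Fintype.card ξ / (s * c) * ∑ x, q (x, b) ^ 2 ≤ s := by
          rw [div_mul_eq_mul_div, div_le_iff₀ (by positivity)]
          calc _ ≤ _ := hcoll b
            _ = _ := by rw [← hs]; ring
        have h7 : (Fintype.card ξ / (s * c) * ∑ x, q (x, b) ^ 2 - s) / Real.log 2 ≤ 0 :=
          div_nonpos_of_nonpos_of_nonneg (by linarith) hl.le
        linarith
    _ = _ := by rw [← Finset.sum_mul, htot, one_mul]

/-- Perfect correlation: the mutual information of a uniform diagonal distribution. -/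
theorem mutualInfo_diagonal [DecidableEq ξ] [Nonempty ξ] :
    mutualInfo (fun o : ξ × ξ => if o.1 = o.2 then (Fintype.card ξ : ℝ)⁻¹ else 0) =
      Real.logb 2 (Fintype.card ξ) := by
  have hn : (Fintype.card ξ : ℝ) ≠ 0 := by exact_mod_cast Fintype.card_ne_zero
  unfold mutualInfo entropy
  rw [Fintype.sum_prod_type]
  simp [hn]

theorem entropy_comp_equiv (e : α ≃ β) (p : β → ℝ) : entropy (p ∘ e) = entropy p := by
  unfold entropy
  rw [← e.sum_comp]
  rfl

theorem mutualInfo_comp_equiv {α' β' : Type*} [Fintype α'] [Fintype β'] (e : α ≃ α')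
    (f : β ≃ β') (p : α' × β' → ℝ) :
    mutualInfo (fun o : α × β => p (e o.1, f o.2)) = mutualInfo p := by
  unfold mutualInfo
  have h1 : (fun a => ∑ b, p (e a, f b)) = (fun a => ∑ b, p (a, b)) ∘ e := by
    funext a
    exact f.sum_comp fun b => p (e a, b)
  have h2 : (fun b => ∑ a, p (e a, f b)) = (fun b => ∑ a, p (a, b)) ∘ f := by
    funext b
    exact e.sum_comp fun a => p (a, f b)
  have h3 : (fun o : α × β => p (e o.1, f o.2)) = p ∘ (e.prodCongr f) := rfl
  simp only [h1, h2, entropy_comp_equiv]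
  rw [h3, entropy_comp_equiv]

end Entropy

-- Measurements on classical-quantum states

section ClassicalQuantum

variable {ξ β Ω Ω' : Type*} [Fintype ξ] [Fintype β] [Fintype Ω] [Fintype Ω']

/-- The Born probability `⟨v| N |v⟩`. -/
noncomputable def bornProb (v : β → ℂ) (N : Matrix β β ℂ) : ℝ := (star v ⬝ᵥ N *ᵥ v).re

theorem ofReal_bornProb {N : Matrix β β ℂ} (hN : N.PosSemidef) (v : β → ℂ) :
    (bornProb v N : ℂ) = star v ⬝ᵥ N *ᵥ v :=
  (Complex.eq_re_of_ofReal_le (r := 0) (by simpa using hN.dotProduct_mulVec_nonneg v)).symm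

theorem bornProb_nonneg {N : Matrix β β ℂ} (hN : N.PosSemidef) (v : β → ℂ) :
    0 ≤ bornProb v N :=
  (Complex.le_def.1 (hN.dotProduct_mulVec_nonneg v)).1

theorem trace_mul_vecMulVec (N : Matrix β β ℂ) (v w : β → ℂ) :
    (N * Matrix.vecMulVec v w).trace = w ⬝ᵥ N *ᵥ v := by
  rw [Matrix.mul_vecMulVec, Matrix.trace_vecMulVec, dotProduct_comm]

variable [DecidableEq β]

/-- The joint distribution of the classical letter and of Bob's outcome. -/
noncomputable def letterDist (v : ξ → β → ℂ) (N : POVM Ω β) : ξ × Ω → ℝ :=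
  fun o => (Fintype.card ξ : ℝ)⁻¹ * bornProb (v o.1) (N.effect o.2)

theorem letterDist_nonneg (v : ξ → β → ℂ) (N : POVM Ω β) (o : ξ × Ω) : 0 ≤ letterDist v N o :=
  mul_nonneg (by positivity) (bornProb_nonneg (N.posSemidef _) _)

theorem sum_letterDist {v : ξ → β → ℂ} (hv : ∀ x, star (v x) ⬝ᵥ v x = 1) (N : POVM Ω β)
    (x : ξ) : ∑ j, letterDist v N (x, j) = (Fintype.card ξ : ℝ)⁻¹ := by
  unfold letterDist bornProb
  dsimp only
  rw [← Finset.mul_sum, ← Complex.re_sum, ← dotProduct_sum, ← Matrix.sum_mulVec, N.sum_eq_one,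
    Matrix.one_mulVec, hv]
  simp

variable [DecidableEq ξ]

/-- The classical-quantum state `|ξ|⁻¹ ∑ₓ |x⟩⟨x| ⊗ |vₓ⟩⟨vₓ|`. -/
noncomputable def cqState (v : ξ → β → ℂ) : Matrix (ξ × β) (ξ × β) ℂ :=
  (Fintype.card ξ : ℂ)⁻¹ •
    ∑ x, Matrix.single x x (1 : ℂ) ⊗ₖ Matrix.vecMulVec (v x) (star (v x))

/-- Only the diagonal of Alice's effects meets a classical register, so her measurement acts as the
stochastic map `x ↦ M_i x x`. -/
theorem outcomeDist_cqState (v : ξ → β → ℂ) (M : POVM Ω ξ) (N : POVM Ω' β) :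
    outcomeDist (cqState v) M N =
      fun o => ∑ x, (M.effect o.1 x x).re * letterDist v N (x, o.2) := by
  funext o
  unfold outcomeDist cqState letterDist
  rw [Matrix.mul_smul, Matrix.trace_smul, Finset.mul_sum, Matrix.trace_sum, Finset.smul_sum,
    Complex.re_sum]
  refine Finset.sum_congr rfl fun x _ => ?_
  rw [← Matrix.mul_kronecker_mul, Matrix.trace_kronecker, Matrix.trace_mul_single,
    trace_mul_vecMulVec, ← ofReal_bornProb (N.posSemidef _)]
  have h : ((Fintype.card ξ : ℂ))⁻¹ = (((Fintype.card ξ : ℝ)⁻¹ : ℝ) : ℂ) := by push_cast; rfl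
  rw [h, smul_eq_mul, Complex.re_ofReal_mul, Complex.re_mul_ofReal]
  simp only [MulOpposite.op_one, one_smul]
  ring

theorem mutualInfo_outcomeDist_cqState_le (v : ξ → β → ℂ) (M : POVM Ω ξ) (N : POVM Ω' β) :
    mutualInfo (outcomeDist (cqState v) M N) ≤ mutualInfo (letterDist v N) := by
  rw [outcomeDist_cqState]
  refine mutualInfo_le_of_stochastic (w := fun a x => (M.effect a x x).re) (q := letterDist v N)
    (fun a x => (Complex.le_def.1 (M.posSemidef a).diag_nonneg).1) (fun x => ?_)
    (letterDist_nonneg v N)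
  rw [← Complex.re_sum, ← Matrix.sum_apply, M.sum_eq_one]
  simp

/-- Reindexing the outcomes of a POVM. -/
def POVM.reindex (e : Ω' ≃ Ω) (M : POVM Ω β) : POVM Ω' β where
  effect ω := M.effect (e ω)
  posSemidef ω := M.posSemidef (e ω)
  sum_eq_one := (e.sum_comp M.effect).trans M.sum_eq_one

/-- The projective measurement in an orthonormal basis. -/
def POVM.ofBasis (v : ξ → β → ℂ)
    (h : ∑ x, Matrix.vecMulVec (v x) (star (v x)) = 1) : POVM ξ β where
  effect x := Matrix.vecMulVec (v x) (star (v x))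
  posSemidef x := Matrix.posSemidef_vecMulVec_self_star (v x)
  sum_eq_one := h

/-- The trivial one-outcome measurement. -/
def POVM.trivial (β : Type*) [Fintype β] [DecidableEq β] : POVM (Fin 1) β where
  effect _ := 1
  posSemidef _ := Matrix.PosSemidef.one
  sum_eq_one := by simp

theorem localInfoValues_nonempty {α : Type*} [Fintype α] [DecidableEq α]
    (ρ : Matrix (α × β) (α × β) ℂ) : (localInfoValues ρ).Nonempty :=
  ⟨_, 1, 1, POVM.trivial α, POVM.trivial β, rfl⟩

theorem mutualInfo_mem_localInfoValues {α : Type*} [Fintype α] [DecidableEq α]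
    (ρ : Matrix (α × β) (α × β) ℂ) (M : POVM Ω α) (N : POVM Ω' β) :
    mutualInfo (outcomeDist ρ M N) ∈ localInfoValues ρ :=
  ⟨_, _, M.reindex (Fintype.equivFin Ω).symm, N.reindex (Fintype.equivFin Ω').symm,
    (mutualInfo_comp_equiv (Fintype.equivFin Ω).symm (Fintype.equivFin Ω').symm
      (outcomeDist ρ M N)).symm⟩

theorem mem_upperBounds_localInfoValues_cqState {v : ξ → β → ℂ}
    (hv : ∀ x, star (v x) ⬝ᵥ v x = 1) :
    Real.logb 2 (Fintype.card ξ) ∈ upperBounds (localInfoValues (cqState v)) := by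
  rintro _ ⟨m, n, M, N, rfl⟩
  exact (mutualInfo_outcomeDist_cqState_le v M N).trans
    (mutualInfo_le_logb_card (letterDist_nonneg v N) (sum_letterDist hv N))

/-- If the letters are encoded in an orthonormal basis, they can be read off perfectly. -/
theorem classicalInfo_cqState_of_basis [Nonempty ξ] {v : ξ → β → ℂ}
    (horth : ∀ x y, star (v x) ⬝ᵥ v y = if x = y then 1 else 0)
    (hcompl : ∑ x, Matrix.vecMulVec (v x) (star (v x)) = 1) :
    classicalInfo (cqState v) = Real.logb 2 (Fintype.card ξ) := by
  have hub := mem_upperBounds_localInfoValues_cqState (v := v) fun x => by simp [horth]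
  refine le_antisymm (csSup_le (localInfoValues_nonempty _) hub) ?_
  have hstd : ∑ x : ξ, Matrix.vecMulVec (Pi.single x (1 : ℂ)) (star (Pi.single x (1 : ℂ))) = 1 := by
    ext i j
    simp [Matrix.sum_apply, Matrix.vecMulVec_apply, Pi.single_apply, Matrix.one_apply]
  have hmem := mutualInfo_mem_localInfoValues (cqState v)
    (POVM.ofBasis (fun x : ξ => Pi.single x (1 : ℂ)) hstd) (POVM.ofBasis v hcompl)
  have hdist : outcomeDist (cqState v)
      (POVM.ofBasis (fun x : ξ => Pi.single x (1 : ℂ)) hstd) (POVM.ofBasis v hcompl) =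
      fun o : ξ × ξ => if o.1 = o.2 then (Fintype.card ξ : ℝ)⁻¹ else 0 := by
    rw [outcomeDist_cqState]
    funext o
    rw [Finset.sum_eq_single o.1]
    · simp [POVM.ofBasis, letterDist, bornProb, Matrix.vecMulVec_apply, Matrix.vecMulVec_mulVec,
        horth, eq_comm]
      split_ifs <;> simp_all
    · intro x _ hx
      simp [POVM.ofBasis, Matrix.vecMulVec_apply, hx]
    · simp
  rw [hdist, mutualInfo_diagonal] at hmem
  exact le_csSup ⟨_, hub⟩ hmem

end ClassicalQuantum

-- Hilbert-Schmidt inequalities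

section Bessel

variable {ξ β : Type*} [Fintype ξ] [Fintype β]

theorem trace_mul_self_re_nonneg {T : Matrix β β ℂ} (hT : T.IsHermitian) :
    0 ≤ (T * T).trace.re := by
  have h := (Matrix.posSemidef_conjTranspose_mul_self T).trace_nonneg
  rw [hT.eq] at h
  exact (Complex.le_def.1 h).1

/-- Bessel's inequality for a family of Hermitian matrices in the Hilbert-Schmidt space, with the
projection given by the coefficients of the matrix. -/
theorem sum_sq_le_trace_mul_self {N : Matrix β β ℂ} (hN : N.IsHermitian) {P : ξ → Matrix β β ℂ}
    (hP : ∀ x, (P x).IsHermitian) {a : ξ → ℝ} (ha : ∀ x, (P x * N).trace.re = a x)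
    (hG : ∀ x, ∑ y, a y * (P x * P y).trace.re = a x) :
    ∑ x, a x ^ 2 ≤ (N * N).trace.re := by
  set S : Matrix β β ℂ := ∑ x, (a x : ℂ) • P x with hS
  have hSh : S.IsHermitian := by
    unfold Matrix.IsHermitian
    simp [hS, Matrix.conjTranspose_sum, (hP _).eq]
  have htr : ∀ A : Matrix β β ℂ, (S * A).trace.re = ∑ x, a x * (P x * A).trace.re := by
    intro A
    simp [hS, Finset.sum_mul, Matrix.trace_sum]
  have h1 : (S * N).trace.re = ∑ x, a x ^ 2 := by
    rw [htr]
    exact Finset.sum_congr rfl fun x _ => by rw [ha, sq]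
  -- `hG` says that the Gram matrix of `P` fixes `a`, so `‖S‖² = aᵀ G a = ∑ a²`.
  have h2 : (S * S).trace.re = ∑ x, a x ^ 2 := by
    rw [htr]
    refine Finset.sum_congr rfl fun x _ => ?_
    rw [Matrix.trace_mul_comm, htr, sq, ← hG x, hG x]
    congr 1
    rw [← hG x]
    exact Finset.sum_congr rfl fun y _ => by rw [Matrix.trace_mul_comm]
  have h3 := trace_mul_self_re_nonneg (hN.sub hSh)
  have h4 : (N - S) * (N - S) = N * N - N * S - S * N + S * S := by noncomm_ring
  rw [h4, Matrix.trace_add, Matrix.trace_sub, Matrix.trace_sub, Matrix.trace_mul_comm N S,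
    Complex.add_re, Complex.sub_re, Complex.sub_re, h1, h2] at h3
  linarith

/-- `tr N² ≤ (tr N)²` for positive semidefinite `N`. -/
theorem trace_mul_self_le {N : Matrix β β ℂ} (hN : N.PosSemidef) :
    (N * N).trace ≤ N.trace ^ 2 := by
  rw [sq, Matrix.trace, Matrix.trace, Finset.sum_mul_sum]
  refine Finset.sum_le_sum fun i _ => ?_
  rw [Matrix.diag_apply, Matrix.mul_apply]
  refine Finset.sum_le_sum fun j _ => ?_
  -- The principal `2 × 2` minor gives `N i j * N j i ≤ N i i * N j j`.
  have h := (hN.submatrix ![i, j]).det_nonneg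
  rw [Matrix.det_fin_two] at h
  simpa using h

theorem trace_projector_mul_projector (v w : β → ℂ) :
    (Matrix.vecMulVec v (star v) * Matrix.vecMulVec w (star w)).trace.re =
      ‖star v ⬝ᵥ w‖ ^ 2 := by
  have h : star w ⬝ᵥ v = star (star v ⬝ᵥ w) := by
    rw [Matrix.star_dotProduct]
  rw [trace_mul_vecMulVec, Matrix.vecMulVec_mulVec, ← Complex.normSq_eq_norm_sq]
  simp [h, dotProduct_smul, Complex.normSq_apply]

end Bessel

-- Mutually unbiased bases and the two states

section Bases

variable {ι τ : Type*} [Fintype ι] [DecidableEq ι]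

/-- The vector `U_t |k⟩`. -/
def basisVec (U : τ → Matrix.unitaryGroup ι ℂ) (x : ι × τ) : ι → ℂ :=
  fun b => (U x.2 : Matrix ι ι ℂ) b x.1

theorem star_basisVec_dotProduct (U : τ → Matrix.unitaryGroup ι ℂ) (x y : ι × τ) :
    star (basisVec U x) ⬝ᵥ basisVec U y =
      ((U x.2 : Matrix ι ι ℂ)ᴴ * (U y.2 : Matrix ι ι ℂ)) x.1 y.1 := rfl

theorem star_basisVec_dotProduct_same (U : τ → Matrix.unitaryGroup ι ℂ) (j k : ι) (t : τ) :
    star (basisVec U (j, t)) ⬝ᵥ basisVec U (k, t) = if j = k then 1 else 0 := by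
  rw [star_basisVec_dotProduct, ← Matrix.star_eq_conjTranspose, Unitary.coe_star_mul_self,
    Matrix.one_apply]

theorem sum_vecMulVec_basisVec (U : τ → Matrix.unitaryGroup ι ℂ) (t : τ) :
    ∑ k, Matrix.vecMulVec (basisVec U (k, t)) (star (basisVec U (k, t))) = 1 := by
  rw [← Unitary.coe_mul_star_self (U t)]
  ext i j
  simp [Matrix.sum_apply, Matrix.vecMulVec_apply, basisVec, Matrix.mul_apply]

theorem basisVec_projector (U : τ → Matrix.unitaryGroup ι ℂ) (k : ι) (t : τ) :
    (U t : Matrix ι ι ℂ) * Matrix.single k k (1 : ℂ) * (U t : Matrix ι ι ℂ)ᴴ =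
      Matrix.vecMulVec (basisVec U (k, t)) (star (basisVec U (k, t))) := by
  ext i j
  simp [Matrix.mul_apply, Matrix.vecMulVec_apply, basisVec, Matrix.single_apply, ite_and]

theorem sum_bornProb_basisVec {N : Matrix ι ι ℂ} (U : τ → Matrix.unitaryGroup ι ℂ) (t : τ) :
    ∑ k, bornProb (basisVec U (k, t)) N = N.trace.re := by
  unfold bornProb
  simp_rw [← trace_mul_vecMulVec]
  rw [← Complex.re_sum, ← Matrix.trace_sum, ← Finset.mul_sum, sum_vecMulVec_basisVec, mul_one]

/-- The vector `|t⟩ ⊗ U_t |k⟩`. -/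
def labelledVec [DecidableEq τ] (U : τ → Matrix.unitaryGroup ι ℂ) (x : ι × τ) : τ × ι → ℂ :=
  adjoinLabel x.2 *ᵥ basisVec U x

theorem labelledVec_apply [DecidableEq τ] (U : τ → Matrix.unitaryGroup ι ℂ) (x : ι × τ) (y : τ × ι) :
    labelledVec U x y = if y.1 = x.2 then basisVec U x y.2 else 0 := by
  simp [labelledVec, adjoinLabel, Matrix.mulVec, dotProduct, ite_and]

variable [Fintype τ]

/-- The collision bound for a complete set of mutually unbiased bases. -/
theorem sum_bornProb_sq_le [Nonempty ι] {U : τ → Matrix.unitaryGroup ι ℂ}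
    (hU : MutuallyUnbiased U) (hcard : Fintype.card τ = Fintype.card ι + 1)
    {N : Matrix ι ι ℂ} (hN : N.PosSemidef) :
    ∑ x, bornProb (basisVec U x) N ^ 2 ≤ 2 * N.trace.re ^ 2 := by
  have hd : (Fintype.card ι : ℝ) ≠ 0 := by exact_mod_cast Fintype.card_ne_zero
  set d : ℝ := (Fintype.card ι : ℝ) with hd_def
  set r : ℝ := N.trace.re with hr
  set n : ι × τ → ℝ := fun x => bornProb (basisVec U x) N with hn
  set P : ι × τ → Matrix ι ι ℂ :=
    fun x => Matrix.vecMulVec (basisVec U x) (star (basisVec U x)) with hP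
  have hsum : ∀ t, ∑ k, n (k, t) = r := fun t => sum_bornProb_basisVec U t
  -- The Gram entries between two different bases all equal `1 / d`, so coefficients with zero sum
  -- in each basis are not mixed across bases.
  have hzero : ∀ t, ∑ k, (n (k, t) - r / d) = 0 := by
    intro t
    rw [Finset.sum_sub_distrib, hsum]
    simp [← hd_def]
    field_simp
    ring
  have hNc : ((r / d : ℝ) : ℂ) • (1 : Matrix ι ι ℂ) = (((r / d : ℝ) : ℂ) • 1)ᴴ := by
    rw [Matrix.conjTranspose_smul]
    simp
  -- Bessel's inequality is applied to the traceless part of `N`; inside one basis the Gram matrix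
  -- is the identity, so the centred coefficients are fixed by it.
  have hbessel := sum_sq_le_trace_mul_self (N := N - ((r / d : ℝ) : ℂ) • 1) (P := P)
    (a := fun x => n x - r / d) (hN.isHermitian.sub hNc.symm)
    (fun x => (Matrix.posSemidef_vecMulVec_self_star _).isHermitian)
    (fun x => by
      have h1 : (P x).trace = 1 := by
        rw [hP, Matrix.trace_vecMulVec, dotProduct_comm]
        simpa using star_basisVec_dotProduct_same U x.1 x.1 x.2
      rw [mul_sub, Matrix.trace_sub, Matrix.trace_mul_comm (P x) N, trace_mul_vecMulVec,
        Matrix.mul_smul, mul_one, Matrix.trace_smul, h1, Complex.sub_re, smul_eq_mul, mul_one,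
        Complex.ofReal_re]
      rfl)
    (fun x => by
      rw [Fintype.sum_prod_type_right, Finset.sum_eq_single x.2]
      · rw [Finset.sum_eq_single x.1]
        · rw [trace_projector_mul_projector, star_basisVec_dotProduct_same]
          simp
        · intro k _ hk
          rw [trace_projector_mul_projector, star_basisVec_dotProduct_same, if_neg hk.symm]
          simp
        · simp
      · intro t _ ht
        have : ∀ k, (P x * P (k, t)).trace.re = (1 / √d) ^ 2 := fun k => by
          rw [trace_projector_mul_projector, star_basisVec_dotProduct, hU x.2 t ht.symm]
        simp_rw [this]
        rw [← Finset.sum_mul, hzero, zero_mul]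
      · simp)
  have hleft : ∑ x, (n x - r / d) ^ 2 = ∑ x, n x ^ 2 - (d + 1) * (r ^ 2 / d) := by
    have : ∀ x, (n x - r / d) ^ 2 = n x ^ 2 - 2 * (r / d) * (n x - r / d) - (r / d) ^ 2 :=
      fun x => by ring
    simp_rw [this]
    rw [Finset.sum_sub_distrib, Finset.sum_sub_distrib, ← Finset.mul_sum,
      Fintype.sum_prod_type_right (fun x => n x - r / d)]
    simp_rw [hzero]
    simp [hcard, ← hd_def]
    field_simp
  have hright : ((N - ((r / d : ℝ) : ℂ) • 1) * (N - ((r / d : ℝ) : ℂ) • 1)).trace.re =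
      (N * N).trace.re - r ^ 2 / d := by
    simp only [sub_mul, mul_sub, Matrix.mul_smul, Matrix.smul_mul, mul_one, one_mul,
      Matrix.trace_sub, Matrix.trace_smul, Matrix.trace_one, smul_eq_mul, Complex.sub_re,
      Complex.re_ofReal_mul, ← hr, Complex.natCast_re, ← hd_def]
    field_simp
    ring
  have hpos := (Complex.le_def.1 (trace_mul_self_le hN)).1
  have him : N.trace.im = 0 := (Complex.le_def.1 hN.trace_nonneg).2.symm
  have hpos' : (N * N).trace.re ≤ r ^ 2 := by
    simpa [sq, him, ← hr] using hpos
  rw [hleft, hright] at hbessel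
  -- The terms `r ^ 2 / d` on the two sides cancel, leaving `∑ n² ≤ tr N² + r² ≤ 2 r²`.
  have : (d + 1) * (r ^ 2 / d) = r ^ 2 + r ^ 2 / d := by field_simp
  linarith

variable [DecidableEq τ]

theorem star_labelledVec_dotProduct (U : τ → Matrix.unitaryGroup ι ℂ) (x y : ι × τ) :
    star (labelledVec U x) ⬝ᵥ labelledVec U y = if x = y then 1 else 0 := by
  obtain ⟨j, s⟩ := x
  obtain ⟨k, t⟩ := y
  have h : star (labelledVec U (j, s)) ⬝ᵥ labelledVec U (k, t) =
      if s = t then star (basisVec U (j, s)) ⬝ᵥ basisVec U (k, t) else 0 := by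
    simp only [dotProduct, Pi.star_apply, labelledVec_apply, Fintype.sum_prod_type]
    rw [Finset.sum_eq_single s]
    · by_cases hst : s = t <;> simp [hst]
    · intro r _ hr
      simp [hr]
    · simp
  rw [h]
  by_cases hst : s = t
  · subst hst
    simp [star_basisVec_dotProduct_same]
  · simp [hst]

theorem lockedState_eq_cqState (U : τ → Matrix.unitaryGroup ι ℂ) :
    lockedState U = cqState (basisVec U) := by
  unfold lockedState cqState
  rw [Fintype.sum_prod_type, Fintype.card_prod]
  simp_rw [basisVec_projector, Matrix.single_kronecker_single, mul_one]
  push_cast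
  rw [mul_comm]

theorem mem_upperBounds_localInfoValues_lockedState [Nonempty ι]
    {U : τ → Matrix.unitaryGroup ι ℂ} (hU : MutuallyUnbiased U)
    (hcard : Fintype.card τ = Fintype.card ι + 1) :
    1 - Real.logb 2 (1 + 1 / (Fintype.card ι : ℝ)) ∈
      upperBounds (localInfoValues (lockedState U)) := by
  have hd : (0 : ℝ) < Fintype.card ι := by exact_mod_cast Fintype.card_pos
  have hτ : Nonempty τ := Fintype.card_pos_iff.1 (by omega)
  -- The constant is `c = 2d / (d + 1)`: for an effect of trace `r`, the letter marginal sums to `r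
  -- / d`, while `|ξ| ∑ q² ≤ 2 r² / (d (d + 1)) = c (r / d)²`.
  have hlog : 1 - Real.logb 2 (1 + 1 / (Fintype.card ι : ℝ)) =
      Real.logb 2 (2 / (1 + 1 / (Fintype.card ι : ℝ))) := by
    rw [Real.logb_div two_ne_zero (by positivity), Real.logb_self_eq_one one_lt_two]
  rw [hlog, lockedState_eq_cqState]
  rintro _ ⟨m, n, M, N, rfl⟩
  refine (mutualInfo_outcomeDist_cqState_le _ M N).trans
    (mutualInfo_le_of_collision (letterDist_nonneg _ N) (sum_letterDist (fun x => ?_) N)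
      (by positivity) fun b => ?_)
  · simpa using star_basisVec_dotProduct_same U x.1 x.1 x.2
  · have h := sum_bornProb_sq_le hU hcard (N.posSemidef b)
    have hs : ∑ x, bornProb (basisVec U x) (N.effect b) =
        (Fintype.card ι + 1) * (N.effect b).trace.re := by
      rw [Fintype.sum_prod_type_right]
      simp_rw [sum_bornProb_basisVec]
      simp [hcard]
    unfold letterDist
    simp_rw [mul_pow]
    rw [← Finset.mul_sum, ← Finset.mul_sum, hs, Fintype.card_prod, hcard]
    push_cast
    set d : ℝ := (Fintype.card ι : ℝ)
    set r : ℝ := (N.effect b).trace.re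
    calc _ = (d * (d + 1))⁻¹ * ∑ x, bornProb (basisVec U x) (N.effect b) ^ 2 := by field_simp
      _ ≤ (d * (d + 1))⁻¹ * (2 * r ^ 2) := mul_le_mul_of_nonneg_left h (by positivity)
      _ = _ := by field_simp

theorem unlockedState_eq_cqState (U : τ → Matrix.unitaryGroup ι ℂ) :
    unlockedState U = cqState (labelledVec U) := by
  unfold unlockedState sendLabel sendLabelKraus
  rw [lockedState_eq_cqState]
  unfold cqState
  simp_rw [Matrix.mul_smul, Matrix.smul_mul]
  rw [← Finset.smul_sum]
  congr 1
  simp_rw [Matrix.mul_sum, Matrix.sum_mul]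
  rw [Finset.sum_comm]
  refine Finset.sum_congr rfl fun x _ => ?_
  have hx : Matrix.single x x (1 : ℂ) =
      Matrix.single x.1 x.1 (1 : ℂ) ⊗ₖ Matrix.single x.2 x.2 (1 : ℂ) := by
    simp [Matrix.single_kronecker_single]
  rw [hx]
  simp_rw [Matrix.conjTranspose_kronecker, ← Matrix.mul_kronecker_mul]
  -- The projector `|t⟩⟨t|` in the Kraus operator annihilates every letter with another label.
  rw [Finset.sum_eq_single x.2]
  · simp [labelledVec, Matrix.mul_vecMulVec, Matrix.vecMulVec_mul, Matrix.star_mulVec]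
  · intro t _ ht
    simp [ht]
  · simp

theorem sum_vecMulVec_labelledVec (U : τ → Matrix.unitaryGroup ι ℂ) :
    ∑ x, Matrix.vecMulVec (labelledVec U x) (star (labelledVec U x)) = 1 := by
  ext ⟨s, i⟩ ⟨t, j⟩
  have h := congrFun (congrFun (sum_vecMulVec_basisVec U s) i) j
  simp only [Matrix.sum_apply, Matrix.vecMulVec_apply, Pi.star_apply, Matrix.one_apply] at h
  simp only [Matrix.sum_apply, Matrix.vecMulVec_apply, Pi.star_apply, labelledVec_apply,
    Fintype.sum_prod_type_right, Matrix.one_apply, Prod.mk.injEq]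
  rw [Finset.sum_eq_single s]
  · by_cases hst : t = s
    · subst hst
      simpa using h
    · simp [hst, Ne.symm hst]
  · intro r _ hr
    simp [Ne.symm hr]
  · simp

end Bases

end QuantumLocking

-- The locking gap

open QuantumLocking in
theorem mainTheorem5 (d : ℕ) (hd : 1 ≤ d)
    (U : Fin (d + 1) → Matrix.unitaryGroup (Fin d) ℂ) (hU : MutuallyUnbiased U) :
    BddAbove (localInfoValues (lockedState U)) ∧
    BddAbove (localInfoValues (unlockedState U)) ∧
    classicalInfo (lockedState U) ≤ 1 - Real.logb 2 (1 + 1 / (d : ℝ)) ∧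
    classicalInfo (unlockedState U) = Real.logb 2 ((d : ℝ) + 1) + Real.logb 2 (d : ℝ) ∧
    classicalInfo (unlockedState U) - classicalInfo (lockedState U)
      ≥ 2 * Real.logb 2 ((d : ℝ) + 1) - 1 := by
  have : Nonempty (Fin d) := ⟨⟨0, hd⟩⟩
  have hd0 : (0 : ℝ) < d := by exact_mod_cast hd
  have hlocked := mem_upperBounds_localInfoValues_lockedState hU (by simp)
  rw [Fintype.card_fin] at hlocked
  have hle : classicalInfo (lockedState U) ≤ 1 - Real.logb 2 (1 + 1 / (d : ℝ)) :=
    csSup_le (localInfoValues_nonempty _) hlocked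
  have horth := star_labelledVec_dotProduct U
  have heq : classicalInfo (unlockedState U) =
      Real.logb 2 ((d : ℝ) + 1) + Real.logb 2 (d : ℝ) := by
    rw [unlockedState_eq_cqState, classicalInfo_cqState_of_basis horth
      (sum_vecMulVec_labelledVec U), ← Real.logb_mul (by positivity) hd0.ne']
    simp [mul_comm]
  refine ⟨⟨_, hlocked⟩, ⟨Real.logb 2 (Fintype.card (Fin d × Fin (d + 1))), ?_⟩, hle, heq, ?_⟩
  · rw [unlockedState_eq_cqState]
    exact mem_upperBounds_localInfoValues_cqState (v := labelledVec U) fun x => by simp [horth]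
  -- Writing `1 + 1 / d = (d + 1) / d` makes the two `log d` terms cancel in the difference.
  · have hlog : Real.logb 2 (1 + 1 / (d : ℝ)) = Real.logb 2 ((d : ℝ) + 1) - Real.logb 2 d := by
      rw [← Real.logb_div (by positivity) hd0.ne']
      congr 1
      field_simp
    rw [heq]
    linarith
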